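/- Conventions. A set-sequence equipped with embeddings (ssee) $\mathbf V$ is a sequence $(V_n)_{n\in\mathbb N}$ of finite sets together with, for all $N\le n$, a collection $\binom{V_n}{V_N}$ of injections $V_N\to V_n$, called embeddings. Let $I(N,n)$ be the number of pairs $(\phi_1,\phi_2)$ of elements of $\binom{V_n}{V_N}$ with $1<|\phi_1(V_N)\cap\phi_2(V_N)|<|V_N|$. The ssee is good if $|V_n|\to\infty$ and, for every $N$ with $|V_N|>1$, $$\frac{\left|\binom{V_n}{V_N}\right|}{|V_n|}\to\infty\quad\text{and}\quad \frac{|V_n|\,I(N,n)}{\left|\binom{V_n}{V_N}\right|^2}\to 0\qquad(n\to\infty).$$ A box in $[0,1]^{V}$ is a product $\prod_{v\in V}A_v$ of measurable sets $A_v\subseteq[0,1]$. It is simple if its projection onto each coordinate is a finite union of intervals (which may be open, closed, half-open or degenerate). For $n \geq N$, $\phi\in\binom{V_n}{V_N}$ and $c\subseteq[0,1]^{V_n}$ a box, let $$c_{\downarrow\phi}=\left\{x\in[0,1]^{V_N}:\ \mathrm{vol}_{V_n\setminus\phi(V_N)}\left(\{y\in c:\ y_{\phi(i)}=x_i\ \forall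 i\in V_N\}\right)>0\right\},$$ where $\mathrm{vol}_{V_n\setminus\phi(V_N)}$ is Lebesgue measure in the coordinates outside $\phi(V_N)$ (if there are no such coordinates, a point has measure $1$). For $b\subseteq[0,1]^{V_N}$ and $n\ge N$, let $$\mathrm{Forb}(b)_n=\left\{y\in[0,1]^{V_n}:\ (y_{\phi(i)})_{i\in V_N}\notin b\ \text{ for all } \phi\in\tbinom{V_n}{V_N}\right\}.$$ Write $\mathbb E_\phi$ for the average over $\phi\in\binom{V_n}{V_N}$ chosen uniformly at random (read as $0$ if there are no embeddings, which for large $n$ can happen only when $|V_N|\le 1$). Theorem. Let $\mathbf V$ be a good ssee, let $N\in\mathbb N$, let $\mathcal F$ be a nonempty finite family of simple boxes in $[0,1]^{V_N}$, and set $b=\bigcup_{b_f\in\mathcal F}b_f$ and $\mathcal P=\mathrm{Forb}(b)$. Then for every $\varepsilon>0$ there exists $n_0>0$ with $n_0\ge N$ such that for every $n\ge n_0$ there exists a finite collection $\mathcal C$ of simple boxes in $[0,1]^{V_n}$ satisfying (i) $\mathcal P_n\subseteq\bigcup_{c\in\mathcal C}c$; (ii) for every $c\in\mathcal C$, $\mathbb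 E_\phi\,\mathrm{vol}\left(c_{\downarrow\phi}\cap b\right)<\varepsilon$; (iii) $|\mathcal C|\le e^{\varepsilon|V_n|}$. -/

import Mathlib

open MeasureTheory Filter Topology
open scoped unitInterval BigOperators

universe u

/-- A set-sequence equipped with embeddings (ssee): a sequence of finite sets `V n` with, for all
`N ≤ n`, a collection `emb N n` of injections from `V N` to `V n`. The values of `emb N n` with
`n < N` carry no information: they are never used below. -/
structure SSEE where
  V : ℕ → Type u
  fintypeV : ∀ n, Fintype (V n)
  emb : ∀ N n : ℕ, Finset (V N ↪ V n)

attribute [instance] SSEE.fintypeV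

namespace SSEE

/-- The number of `i`-intersecting embeddings of `(V N₁, V N₂)` into `V n`. A function on the
disjoint union of `V N₁` and `V N₂` is given here by its two restrictions. -/
noncomputable def numIntersecting (S : SSEE.{u}) (i N₁ N₂ n : ℕ) : ℕ :=
  Set.ncard {φ : (S.V N₁ ↪ S.V n) × (S.V N₂ ↪ S.V n) |
    φ.1 ∈ S.emb N₁ n ∧ φ.2 ∈ S.emb N₂ n ∧ (Set.range φ.1 ∩ Set.range φ.2).ncard = i}

/-- The quantity `I(N, n)`: the number of pairs of embeddings of `V N` into `V n` whose images
share more than one and fewer than `|V N|` elements. -/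
noncomputable def overlap (S : SSEE.{u}) (N n : ℕ) : ℕ :=
  ∑ i ∈ Finset.Ioo 1 (Fintype.card (S.V N)), S.numIntersecting i N N n

/-- Good ssee-s. -/
structure IsGood (S : SSEE.{u}) : Prop where
  card_tendsto : Tendsto (fun n => Fintype.card (S.V n)) atTop atTop
  many_embeddings : ∀ N, 1 < Fintype.card (S.V N) →
    Tendsto (fun n => ((S.emb N n).card : ℝ) / (Fintype.card (S.V n) : ℝ)) atTop atTop
  small_overlap : ∀ N, 1 < Fintype.card (S.V N) →
    Tendsto (fun n => ((Fintype.card (S.V n) : ℝ) * (S.overlap N n : ℝ)) /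
      ((S.emb N n).card : ℝ) ^ 2) atTop (𝓝 0)

end SSEE

/-- A finite union of (open, closed, half-open, possibly degenerate) intervals in `[0,1]`. -/
def IsFiniteUnionOfIntervals (A : Set I) : Prop :=
  ∃ T : Set (Set I), T.Finite ∧ (∀ J ∈ T, J.OrdConnected) ∧ A = ⋃₀ T

/-- A box in `[0,1]^V`: a product of measurable subsets of `[0,1]`. -/
def IsBox {V : Type u} (b : Set (V → I)) : Prop :=
  ∃ A : V → Set I, (∀ v, MeasurableSet (A v)) ∧ b = Set.univ.pi A

/-- A simple box: a box whose projection to every coordinate is a finite union of intervals. -/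
def IsSimpleBox {V : Type u} (b : Set (V → I)) : Prop :=
  IsBox b ∧ ∀ v, IsFiniteUnionOfIntervals ((fun c : V → I => c v) '' b)

open Classical in
/-- The strict `φ`-projection of `b ⊆ [0,1]^W` for an injection `φ : V → W`: the points `c` of
`[0,1]^V` such that the section of `b` over `c`, seen in the coordinates outside the range of `φ`,
has positive Lebesgue measure in `[0,1]^(W \ φ(V))`. -/
def projDown {V W : Type u} [Fintype W] (φ : V ↪ W) (b : Set (W → I)) : Set (V → I) :=
  {c | 0 < (volume : Measure ({w : W // w ∉ Set.range φ} → I))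
    {d | ∃ c' ∈ b, (∀ v, c' (φ v) = c v) ∧ ∀ w, c' w.1 = d w}}

/-- The `φ`-lift of `b ⊆ [0,1]^V` for an injection `φ : V → W`. -/
def liftUp {V W : Type u} (φ : V ↪ W) (b : Set (V → I)) : Set (W → I) :=
  {c | ∃ c' ∈ b, ∀ v, c' v = c (φ v)}

namespace SSEE

/-- The upper shadow of `b ⊆ [0,1]^(V N)` in `[0,1]^(V n)`. -/
def upperShadow (S : SSEE.{u}) {N : ℕ} (b : Set (S.V N → I)) (n : ℕ) : Set (S.V n → I) :=
  ⋃ φ ∈ S.emb N n, liftUp φ b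

/-- The property of being `b`-free, for `b ⊆ [0,1]^(V N)` and `n ≥ N`. -/
def Forb (S : SSEE.{u}) {N : ℕ} (b : Set (S.V N → I)) (n : ℕ) : Set (S.V n → I) :=
  (S.upperShadow b n)ᶜ

end SSEE

/-! Finitely many intervals describe `b`, so a finite partition of `[0,1]` into intervals, a
colouring `κ : I → K`, makes `b` a union of colour cells (`exists_colouring_of_simpleBoxes`). Take
the hypergraph on `V n × K` whose edges are the copies, one per embedding, of the colour patterns
occurring in `b`. The graph of `κ ∘ y` is independent when `y` is `b`-free, so containers for
independent sets, read as template boxes, cover `Forb b n`. Few edges inside a container means few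
forbidden patterns per embedding on average, which bounds the volume in (ii).

Goodness says that few pairs of edges share two vertices (`IsGood.eventually_overlapPairs_le`), and
this is all that `exists_containers` needs. Its proof lowers, one unit at a time, the level `j` for
which few edges inside the container `C ⊇ J` have at least `j` vertices in `J`. At level `r` there
are none, by independence; at level `0` the statement concerns all edges inside `C`.

In one step (`exists_pruned`) a sparse random `T ⊆ J` is a fingerprint. By Chebyshev, link degrees
into `T` reflect those into `J`, since the variance is governed by overlapping pairs
(`exists_sparse_subset`). Vertices of high degree into `T` are deleted from `C`; the few of them in
`J` are kept by a second fingerprint `S`. The new container depends only on `C`, `T`, `S`, so there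
are subexponentially many. -/

/-! ### Random subsets and the second moment method -/

/-- The probability that the random subset of `J` in which every element is kept independently
with probability `q` is equal to `T`. -/
noncomputable def binomWeight {X : Type*} (q : ℝ) (J T : Finset X) : ℝ :=
  q ^ T.card * (1 - q) ^ (J.card - T.card)

lemma binomWeight_nonneg {X : Type*} {q : ℝ} (h0 : 0 ≤ q) (h1 : q ≤ 1) (J T : Finset X) :
    0 ≤ binomWeight q J T :=
  mul_nonneg (pow_nonneg h0 _) (pow_nonneg (sub_nonneg.2 h1) _)

/-- For `T = A ∪ T'` with `T' ⊆ J \ A` the weight is `q ^ |A|` times the weight of `T'` in `J \ A`,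
and the latter weights sum to 1 by the binomial theorem. -/
lemma sum_binomWeight_superset {X : Type*} [DecidableEq X] (q : ℝ) {A J : Finset X} (hA : A ⊆ J) :
    ∑ T ∈ J.powerset, (if A ⊆ T then binomWeight q J T else 0) = q ^ A.card := by
  rw [← Finset.sum_filter]
  have hJ : J.powerset.filter (fun T => A ⊆ T) = (J \ A).powerset.image (A ∪ ·) := by
    rw [← Finset.Icc_eq_image_powerset hA]
    ext T
    simp [and_comm]
  rw [hJ, Finset.sum_image]
  · have key := Finset.sum_pow_mul_eq_add_pow q (1 - q) (J \ A)
    rw [add_sub_cancel, one_pow] at key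
    rw [← mul_one (q ^ A.card), ← key, Finset.mul_sum]
    refine Finset.sum_congr rfl fun T hT => ?_
    rw [Finset.mem_powerset] at hT
    have hd : Disjoint A T := Finset.disjoint_sdiff.mono_right hT
    rw [binomWeight, Finset.card_union_of_disjoint hd, Finset.card_sdiff_of_subset hA, pow_add,
      Nat.sub_add_eq]
    ring
  · intro T hT T' hT' h
    have h1 : Disjoint A T := Finset.disjoint_sdiff.mono_right (Finset.mem_powerset.1 hT)
    have h2 : Disjoint A T' := Finset.disjoint_sdiff.mono_right (Finset.mem_powerset.1 hT')
    simp only at h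
    rw [← Finset.union_sdiff_cancel_left h1, h, Finset.union_sdiff_cancel_left h2]

lemma sum_binomWeight {X : Type*} [DecidableEq X] (q : ℝ) (J : Finset X) :
    ∑ T ∈ J.powerset, binomWeight q J T = 1 := by
  simpa using sum_binomWeight_superset q (Finset.empty_subset J)

/-- Linearity of expectation. -/
lemma sum_binomWeight_mul_card {X κ : Type*} [DecidableEq X] (q : ℝ) {J : Finset X}
    (Q : Finset κ) (A : κ → Finset X) (hA : ∀ p ∈ Q, A p ⊆ J) :
    ∑ T ∈ J.powerset, binomWeight q J T * ((Q.filter fun p => A p ⊆ T).card : ℝ) =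
      ∑ p ∈ Q, q ^ (A p).card := by
  simp_rw [Finset.card_filter, Nat.cast_sum, Finset.mul_sum]
  rw [Finset.sum_comm]
  refine Finset.sum_congr rfl fun p hp => ?_
  rw [← sum_binomWeight_superset q (hA p hp)]
  refine Finset.sum_congr rfl fun T _ => ?_
  split_ifs <;> simp

lemma sum_binomWeight_mul_card_self {X : Type*} [DecidableEq X] (q : ℝ) (J : Finset X) :
    ∑ T ∈ J.powerset, binomWeight q J T * (T.card : ℝ) = q * J.card := by
  have h := sum_binomWeight_mul_card q J (fun x => ({x} : Finset X))
    (fun x hx => Finset.singleton_subset_iff.2 hx)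
  simp only [Finset.card_singleton, pow_one, Finset.sum_const, nsmul_eq_mul,
    Finset.singleton_subset_iff] at h
  rw [mul_comm, ← h]
  refine Finset.sum_congr rfl fun T hT => ?_
  rw [Finset.filter_mem_eq_inter, Finset.inter_eq_right.2 (Finset.mem_powerset.1 hT)]

/-- The variance of the number of members of a uniform family that lie in a random set is at most
the number of intersecting pairs of members. -/
lemma sum_binomWeight_mul_sq_le {X κ : Type*} [DecidableEq X] {q : ℝ}
    (h0 : 0 ≤ q) (h1 : q ≤ 1) {J : Finset X} {j : ℕ} (Q : Finset κ) (A : κ → Finset X)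
    (hA : ∀ p ∈ Q, A p ⊆ J) (hj : ∀ p ∈ Q, (A p).card = j) :
    ∑ T ∈ J.powerset,
        binomWeight q J T * (((Q.filter fun p => A p ⊆ T).card : ℝ) - q ^ j * Q.card) ^ 2 ≤
      (((Q ×ˢ Q).filter fun p => ¬ Disjoint (A p.1) (A p.2)).card : ℝ) := by
  have hm1 : ∑ T ∈ J.powerset, binomWeight q J T * ((Q.filter fun p => A p ⊆ T).card : ℝ) =
      q ^ j * Q.card := by
    rw [sum_binomWeight_mul_card q Q A hA, Finset.sum_congr rfl fun p hp => by rw [hj p hp]]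
    simp [mul_comm]
  have hm2 : ∑ T ∈ J.powerset,
      binomWeight q J T * ((Q.filter fun p => A p ⊆ T).card : ℝ) ^ 2 =
      ∑ p ∈ Q ×ˢ Q, q ^ (A p.1 ∪ A p.2).card := by
    rw [← sum_binomWeight_mul_card q (J := J) (Q ×ˢ Q) (fun p => A p.1 ∪ A p.2)]
    · refine Finset.sum_congr rfl fun T _ => ?_
      simp_rw [Finset.union_subset_iff]
      rw [Finset.filter_product (s := Q) (t := Q) (fun p => A p ⊆ T) (fun p => A p ⊆ T),
        Finset.card_product]
      push_cast
      ring
    · intro p hp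
      rw [Finset.mem_product] at hp
      exact Finset.union_subset (hA _ hp.1) (hA _ hp.2)
  have hexp : ∑ T ∈ J.powerset,
        binomWeight q J T * (((Q.filter fun p => A p ⊆ T).card : ℝ) - q ^ j * Q.card) ^ 2 =
      ∑ p ∈ Q ×ˢ Q, q ^ (A p.1 ∪ A p.2).card - (q ^ j * Q.card) ^ 2 := by
    have : ∀ T, binomWeight q J T *
        (((Q.filter fun p => A p ⊆ T).card : ℝ) - q ^ j * Q.card) ^ 2 =
        binomWeight q J T * ((Q.filter fun p => A p ⊆ T).card : ℝ) ^ 2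
        - 2 * (q ^ j * Q.card) * (binomWeight q J T * ((Q.filter fun p => A p ⊆ T).card : ℝ))
        + (q ^ j * Q.card) ^ 2 * binomWeight q J T := fun T => by ring
    simp_rw [this]
    rw [Finset.sum_add_distrib, Finset.sum_sub_distrib, ← Finset.mul_sum, ← Finset.mul_sum, hm1,
      hm2, sum_binomWeight]
    ring
  have hsq : (q ^ j * (Q.card : ℝ)) ^ 2 = ∑ p ∈ Q ×ˢ Q, q ^ (2 * j) := by
    rw [Finset.sum_const, Finset.card_product, nsmul_eq_mul]
    push_cast
    ring
  rw [hexp, hsq, ← Finset.sum_sub_distrib, Finset.card_filter, Nat.cast_sum]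
  refine Finset.sum_le_sum fun p hp => ?_
  rw [Finset.mem_product] at hp
  -- Disjoint members survive independently, so their covariance vanishes; any other pair
  -- contributes at most 1.
  by_cases hd : Disjoint (A p.1) (A p.2)
  · rw [Finset.card_union_of_disjoint hd, hj _ hp.1, hj _ hp.2]
    simp [hd, two_mul]
  · have := pow_le_one₀ h0 h1 (n := (A p.1 ∪ A p.2).card)
    have := pow_nonneg h0 (2 * j)
    simp only [hd, not_false_eq_true, if_true, Nat.cast_one]
    linarith

/-- Chebyshev's inequality for the number of members of a uniform family in a random set. -/
lemma sum_binomWeight_small_le {X κ : Type*} [DecidableEq X] {q : ℝ}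
    (h0 : 0 < q) (h1 : q ≤ 1) {J : Finset X} {j : ℕ} (Q : Finset κ) (A : κ → Finset X)
    (hA : ∀ p ∈ Q, A p ⊆ J) (hj : ∀ p ∈ Q, (A p).card = j) (D : ℝ)
    (hD : 2 * D < q ^ j * Q.card) (hQ : 0 < Q.card) :
    ∑ T ∈ J.powerset,
        (if ((Q.filter fun p => A p ⊆ T).card : ℝ) ≤ D then binomWeight q J T else 0) ≤
      4 * (((Q ×ˢ Q).filter fun p => ¬ Disjoint (A p.1) (A p.2)).card : ℝ) /
        (q ^ j * Q.card) ^ 2 := by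
  have hQ' : (0 : ℝ) < Q.card := by exact_mod_cast hQ
  have hpos : 0 < q ^ j * (Q.card : ℝ) := by positivity
  rw [le_div_iff₀ (by positivity), Finset.sum_mul]
  calc _ ≤ ∑ T ∈ J.powerset, 4 * (binomWeight q J T *
        (((Q.filter fun p => A p ⊆ T).card : ℝ) - q ^ j * Q.card) ^ 2) := by
        refine Finset.sum_le_sum fun T _ => ?_
        have hw := binomWeight_nonneg h0.le h1 J T
        split_ifs with h
        · rw [mul_left_comm]
          refine mul_le_mul_of_nonneg_left ?_ hw
          -- As `D` is below half the mean, a count of at most `D` deviates by at least half the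
          -- mean; hence the factor 4.
          have h2 : q ^ j * (Q.card : ℝ) / 2 ≤
            q ^ j * Q.card - ((Q.filter fun p => A p ⊆ T).card : ℝ) := by linarith
          have := pow_le_pow_left₀ (by positivity) h2 2
          nlinarith
        · rw [zero_mul]
          positivity
    _ ≤ _ := by
        rw [← Finset.mul_sum]
        exact mul_le_mul_of_nonneg_left (sum_binomWeight_mul_sq_le h0.le h1 Q A hA hj) (by norm_num)

lemma exists_subset_le_of_sum_binomWeight_le {X : Type*} [DecidableEq X] {q : ℝ} (h0 : 0 ≤ q)
    (h1 : q ≤ 1) (J : Finset X) (Φ : Finset X → ℝ) (a : ℝ)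
    (h : ∑ T ∈ J.powerset, binomWeight q J T * Φ T ≤ a) : ∃ T ⊆ J, Φ T ≤ a := by
  by_contra! hc
  have hw := sum_binomWeight q J
  have : ∑ T ∈ J.powerset, binomWeight q J T * a < ∑ T ∈ J.powerset, binomWeight q J T * Φ T := by
    refine Finset.sum_lt_sum (fun T hT => mul_le_mul_of_nonneg_left
      (hc T (Finset.mem_powerset.1 hT)).le (binomWeight_nonneg h0 h1 J T)) ?_
    obtain ⟨T, hT, hT'⟩ := Finset.exists_ne_zero_of_sum_ne_zero (hw.trans_ne one_ne_zero)
    exact ⟨T, hT, mul_lt_mul_of_pos_left (hc T (Finset.mem_powerset.1 hT))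
      (lt_of_le_of_ne (binomWeight_nonneg h0 h1 J T) hT'.symm)⟩
  rw [← Finset.sum_mul, hw, one_mul] at this
  linarith

-- Hypergraph links and the pruning step

universe v

/-- The edges of a hypergraph inside `C` that have at least `j` elements in `J`. -/
def richEdges {X ι : Type*} [DecidableEq X] (E : Finset ι) (h : ι → Finset X) (C J : Finset X)
    (j : ℕ) : Finset ι :=
  E.filter fun e => h e ⊆ C ∧ j ≤ (h e ∩ J).card

/-- The pairs of an edge inside `C` through `v` and a set of `j` further elements of this edge, all
of them in `T`. -/
def linkPairs {X ι : Type*} [DecidableEq X] (E : Finset ι) (h : ι → Finset X) (C T : Finset X)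
    (j : ℕ) (v : X) : Finset (Σ _ : ι, Finset X) :=
  (E.filter fun e => h e ⊆ C ∧ v ∈ h e).sigma fun e => ((h e).erase v ∩ T).powersetCard j

/-- The pairs of edges with at least two common elements. -/
def overlapPairs {X ι : Type*} [DecidableEq X] (E : Finset ι) (h : ι → Finset X) :
    Finset (ι × ι) :=
  (E ×ˢ E).filter fun p => 2 ≤ (h p.1 ∩ h p.2).card

/-- The set left of `C` after deletion of the elements outside `S` of link degree above `D`. -/
noncomputable def pruned {X ι : Type*} [DecidableEq X] (E : Finset ι) (h : ι → Finset X) (j : ℕ)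
    (D : ℝ) (C T S : Finset X) : Finset X :=
  C.filter fun v => ((linkPairs E h C T j v).card : ℝ) ≤ D ∨ v ∈ S

section Step

variable {X ι : Type*} [DecidableEq X] (E : Finset ι) (h : ι → Finset X)

lemma mem_linkPairs {C T : Finset X} {j : ℕ} {v : X} {p : Σ _ : ι, Finset X} :
    p ∈ linkPairs E h C T j v ↔ (p.1 ∈ E ∧ h p.1 ⊆ C ∧ v ∈ h p.1) ∧
      (p.2 ⊆ (h p.1).erase v ∧ p.2 ⊆ T) ∧ p.2.card = j := by
  rw [linkPairs, Finset.mem_sigma, Finset.mem_filter, Finset.mem_powersetCard,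
    Finset.subset_inter_iff]

lemma filter_linkPairs {C J T : Finset X} (hT : T ⊆ J) (j : ℕ) (v : X) :
    (linkPairs E h C J j v).filter (fun p => p.2 ⊆ T) = linkPairs E h C T j v := by
  ext p
  rw [Finset.mem_filter, mem_linkPairs, mem_linkPairs]
  constructor
  · rintro ⟨⟨h1, ⟨h2, _⟩, h3⟩, h4⟩
    exact ⟨h1, ⟨h2, h4⟩, h3⟩
  · rintro ⟨h1, ⟨h2, h4⟩, h3⟩
    exact ⟨⟨h1, ⟨h2, h4.trans hT⟩, h3⟩, h4⟩

lemma card_linkPairs_mono {C J T : Finset X} (hT : T ⊆ J) (j : ℕ) (v : X) :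
    (linkPairs E h C T j v).card ≤ (linkPairs E h C J j v).card := by
  rw [← filter_linkPairs E h hT]
  exact Finset.card_filter_le _ _

/-- The intersecting pairs of members of a link come from overlapping pairs of edges. -/
lemma card_intersecting_linkPairs_le {r : ℕ} (hr : ∀ e ∈ E, (h e).card = r) (C J : Finset X)
    (j : ℕ) (v : X) :
    ((linkPairs E h C J j v ×ˢ linkPairs E h C J j v).filter
        fun p => ¬ Disjoint p.1.2 p.2.2).card ≤
      4 ^ r * ((overlapPairs E h).filter fun p => v ∈ h p.1 ∩ h p.2).card := by
  classical
  refine Finset.card_le_mul_card_image_of_maps_to (f := fun p => (p.1.1, p.2.1)) ?_ _ ?_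
  · rintro ⟨⟨e, A⟩, ⟨e', A'⟩⟩ hp
    simp only [Finset.mem_filter, Finset.mem_product, mem_linkPairs, overlapPairs,
      Finset.mem_inter] at hp ⊢
    obtain ⟨⟨⟨⟨he, hC, hv⟩, ⟨hA, -⟩, -⟩, ⟨⟨he', hC', hv'⟩, ⟨hA', -⟩, -⟩⟩, hd⟩ := hp
    refine ⟨⟨⟨he, he'⟩, ?_⟩, hv, hv'⟩
    -- Both sets avoid `v`, so a common element `x` is a second common vertex of the two edges.
    obtain ⟨x, hx, hx'⟩ := Finset.not_disjoint_iff.1 hd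
    have h1 := Finset.mem_erase.1 (hA hx)
    have h2 := Finset.mem_erase.1 (hA' hx')
    rw [Nat.succ_le_iff, Finset.one_lt_card]
    exact ⟨x, Finset.mem_inter.2 ⟨h1.2, h2.2⟩, v, Finset.mem_inter.2 ⟨hv, hv'⟩, h1.1⟩
  · rintro ⟨e, e'⟩ hb
    simp only [overlapPairs, Finset.mem_filter, Finset.mem_product] at hb
    have hc : ((h e).powerset ×ˢ (h e').powerset).card = 4 ^ r := by
      rw [Finset.card_product, Finset.card_powerset, Finset.card_powerset, hr e hb.1.1.1,
        hr e' hb.1.1.2, ← mul_pow]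
      norm_num
    rw [← hc]
    refine Finset.card_le_card_of_injOn (fun p => (p.1.2, p.2.2)) ?_ ?_
    · rintro ⟨⟨e1, A⟩, ⟨e2, A'⟩⟩ hp
      simp only [Finset.coe_filter, Finset.mem_filter, Finset.mem_product, mem_linkPairs,
        Set.mem_ofPred_eq, Prod.mk.injEq] at hp
      obtain ⟨⟨⟨⟨_, ⟨hA, -⟩, -⟩, ⟨_, ⟨hA', -⟩, -⟩⟩, hd⟩, rfl, rfl⟩ := hp
      simp only [Finset.coe_product, Set.mem_prod, Finset.mem_coe, Finset.mem_powerset]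
      exact ⟨hA.trans (Finset.erase_subset _ _), hA'.trans (Finset.erase_subset _ _)⟩
    · rintro ⟨⟨e1, A⟩, ⟨e2, A'⟩⟩ hp ⟨⟨e3, B⟩, ⟨e4, B'⟩⟩ hp' heq
      simp only [Finset.coe_filter, Set.mem_ofPred_eq, Prod.mk.injEq] at hp hp' heq
      obtain ⟨-, rfl, rfl⟩ := hp
      obtain ⟨-, rfl, rfl⟩ := hp'
      obtain ⟨rfl, rfl⟩ := heq
      rfl

/-- Double counting: each pair is counted once per common vertex in `C`, hence at most `r` times. -/
lemma sum_card_overlapPairs_le {r : ℕ} (hr : ∀ e ∈ E, (h e).card = r) (C : Finset X) :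
    ∑ v ∈ C, ((overlapPairs E h).filter fun p => v ∈ h p.1 ∩ h p.2).card ≤
      r * (overlapPairs E h).card := by
  simp_rw [Finset.card_filter]
  rw [Finset.sum_comm, mul_comm, ← smul_eq_mul]
  refine Finset.sum_le_card_nsmul _ _ _ fun p hp => ?_
  rw [← Finset.card_filter]
  simp only [overlapPairs, Finset.mem_filter, Finset.mem_product] at hp
  rw [← hr p.1 hp.1.1]
  refine Finset.card_le_card fun v hv => ?_
  exact (Finset.mem_inter.1 (Finset.mem_filter.1 hv).2).1

/-- The total link degree of the elements of `J` is controlled by the edges with more than `j`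
elements in `J`. -/
lemma sum_card_linkPairs_le {r : ℕ} (hr : ∀ e ∈ E, (h e).card = r) (C J : Finset X) (j : ℕ) :
    ∑ v ∈ J, (linkPairs E h C J j v).card ≤ r * 2 ^ r * (richEdges E h C J (j + 1)).card := by
  have h1 : ∀ v ∈ J, (linkPairs E h C J j v).card ≤
      ∑ e ∈ richEdges E h C J (j + 1), if v ∈ h e then 2 ^ r else 0 := by
    intro v hv
    rw [linkPairs, Finset.card_sigma, Finset.sum_filter, richEdges, Finset.sum_filter]
    refine Finset.sum_le_sum fun e he => ?_
    by_cases hc : h e ⊆ C ∧ v ∈ h e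
    · rw [if_pos hc]
      -- Since `v` itself lies in `J`, having `j` further vertices in `J` takes `j + 1` in all.
      by_cases hj : j + 1 ≤ (h e ∩ J).card
      · rw [if_pos ⟨hc.1, hj⟩, if_pos hc.2, ← hr e he, ← Finset.card_powerset]
        refine Finset.card_le_card fun A hA => ?_
        rw [Finset.mem_powersetCard] at hA
        exact Finset.mem_powerset.2
          (hA.1.trans (Finset.inter_subset_left.trans (Finset.erase_subset _ _)))
      · rw [Finset.card_powersetCard, Nat.choose_eq_zero_of_lt]
        · exact Nat.zero_le _
        · rw [Finset.erase_inter, Finset.card_erase_of_mem (Finset.mem_inter.2 ⟨hc.2, hv⟩)]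
          have : 0 < (h e ∩ J).card :=
            Finset.card_pos.2 ⟨v, Finset.mem_inter.2 ⟨hc.2, hv⟩⟩
          omega
    · rw [if_neg hc]
      exact Nat.zero_le _
  refine (Finset.sum_le_sum h1).trans ?_
  rw [Finset.sum_comm, mul_comm _ (Finset.card _), ← smul_eq_mul (Finset.card _)]
  refine Finset.sum_le_card_nsmul _ _ _ fun e he => ?_
  rw [← Finset.sum_filter, Finset.sum_const, smul_eq_mul]
  refine Nat.mul_le_mul_right _ ?_
  rw [← hr e (Finset.mem_filter.1 he).1]
  exact Finset.card_le_card fun v hv => (Finset.mem_filter.1 hv).2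

/-- Every edge inside `C'` with at least `j` elements in `J` is seen from one of its elements. -/
lemma card_richEdges_le {r j : ℕ} (hr : ∀ e ∈ E, (h e).card = r) (hj : j < r) {C C' : Finset X}
    (hC : C' ⊆ C) (J : Finset X) :
    (richEdges E h C' J j).card ≤ ∑ v ∈ C', (linkPairs E h C J j v).card := by
  classical
  rw [← Finset.card_sigma]
  have : ∀ e ∈ richEdges E h C' J j, ∃ p : (Σ _ : X, Σ _ : ι, Finset X),
      p ∈ C'.sigma (fun v => linkPairs E h C J j v) ∧ p.2.1 = e := by
    intro e he
    simp only [richEdges, Finset.mem_filter] at he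
    obtain ⟨he, heC, hej⟩ := he
    obtain ⟨A, hA, hAj⟩ := Finset.exists_subset_card_eq hej
    -- As `j < r`, some vertex of the edge is left over, and the edge is counted in its link.
    obtain ⟨v, hv, hvA⟩ : ∃ v ∈ h e, v ∉ A :=
      Finset.exists_mem_notMem_of_card_lt_card (by rw [hAj, hr e he]; exact hj)
    refine ⟨⟨v, e, A⟩, ?_, rfl⟩
    rw [Finset.mem_sigma, mem_linkPairs]
    rw [Finset.subset_inter_iff] at hA
    exact ⟨heC hv, ⟨he, heC.trans hC, hv⟩, ⟨fun x hx => Finset.mem_erase.2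
      ⟨ne_of_mem_of_not_mem hx hvA, hA.1 hx⟩, hA.2⟩, hAj⟩
  refine Finset.card_le_card_of_surjOn (fun p => p.2.1) ?_
  intro e he
  obtain ⟨p, hp, hpe⟩ := this e he
  exact ⟨p, hp, hpe⟩

/-- A sparse random subset `T` of `J` whose link degrees reflect those of `J`. -/
lemma exists_sparse_subset [Fintype X] {r j : ℕ} (hr : ∀ e ∈ E, (h e).card = r) {q D B : ℝ}
    (hq0 : 0 < q) (hq1 : q ≤ 1) (hD : 0 < D) (hB : 0 < B)
    (hO : 2 * 4 ^ r * r * ((overlapPairs E h).card : ℝ) ≤ B * (q ^ j * D)) (C J : Finset X)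
    (hX : 0 < Fintype.card X) :
    ∃ T ⊆ J, (T.card : ℝ) ≤ 2 * q * Fintype.card X ∧
      ∑ v ∈ C, (if ((linkPairs E h C T j v).card : ℝ) ≤ D then
        ((linkPairs E h C J j v).card : ℝ) else 0) ≤ 2 * D / q ^ j * Fintype.card X + 2 * B := by
  have hX' : (0 : ℝ) < Fintype.card X := by exact_mod_cast hX
  have hqj : 0 < q ^ j := pow_pos hq0 j
  -- The degree into `J` carried by vertices whose expected degree into `T` exceeds `2 * D` but
  -- whose actual one is at most `D`.
  let bad : Finset X → ℝ := fun T => ∑ v ∈ C,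
    (if 2 * D < q ^ j * (linkPairs E h C J j v).card then
      (if ((linkPairs E h C T j v).card : ℝ) ≤ D then
        ((linkPairs E h C J j v).card : ℝ) else 0) else 0)
  have hbad0 : ∀ T, 0 ≤ bad T := fun T => Finset.sum_nonneg fun v _ => by
    split_ifs <;> positivity
  have hbad : ∑ T ∈ J.powerset, binomWeight q J T * bad T ≤ B := by
    simp only [bad, Finset.mul_sum]
    rw [Finset.sum_comm]
    have hv : ∀ v ∈ C, ∑ T ∈ J.powerset, binomWeight q J T *
        (if 2 * D < q ^ j * (linkPairs E h C J j v).card then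
          (if ((linkPairs E h C T j v).card : ℝ) ≤ D then
            ((linkPairs E h C J j v).card : ℝ) else 0) else 0) ≤
        2 * 4 ^ r / (q ^ j * D) *
          (((overlapPairs E h).filter fun p => v ∈ h p.1 ∩ h p.2).card : ℝ) := by
      intro v _
      set d : ℝ := ((linkPairs E h C J j v).card : ℝ) with hd
      by_cases hlarge : 2 * D < q ^ j * d
      · have hdpos : 0 < d := by
          by_contra hneg
          have := mul_nonpos_of_nonneg_of_nonpos hqj.le (not_lt.1 hneg)
          linarith
        have hcheb := sum_binomWeight_small_le hq0 hq1 (J := J) (j := j)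
          (linkPairs E h C J j v) (fun p => p.2)
          (fun p hp => ((mem_linkPairs E h).1 hp).2.1.2) (fun p hp => ((mem_linkPairs E h).1 hp).2.2)
          D hlarge (by rw [hd] at hdpos; exact_mod_cast hdpos)
        have hR : (((linkPairs E h C J j v ×ˢ linkPairs E h C J j v).filter
            fun p => ¬ Disjoint p.1.2 p.2.2).card : ℝ) ≤
            4 ^ r * (((overlapPairs E h).filter fun p => v ∈ h p.1 ∩ h p.2).card : ℝ) := by
          exact_mod_cast card_intersecting_linkPairs_le E h hr C J j v
        set R : ℝ := (((linkPairs E h C J j v ×ˢ linkPairs E h C J j v).filter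
            fun p => ¬ Disjoint p.1.2 p.2.2).card : ℝ)
        set O : ℝ := (((overlapPairs E h).filter fun p => v ∈ h p.1 ∩ h p.2).card : ℝ)
        calc _ = d * ∑ T ∈ J.powerset, (if (((linkPairs E h C J j v).filter
                fun p => p.2 ⊆ T).card : ℝ) ≤ D then binomWeight q J T else 0) := by
              rw [Finset.mul_sum]
              refine Finset.sum_congr rfl fun T hT => ?_
              rw [if_pos hlarge, filter_linkPairs E h (Finset.mem_powerset.1 hT)]
              split_ifs <;> ring
          _ ≤ d * (4 * R / (q ^ j * d) ^ 2) := mul_le_mul_of_nonneg_left hcheb hdpos.le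
          _ = 4 * R / (q ^ j * (q ^ j * d)) := by
              field_simp
          -- Weighting by `d` cancels one factor of the squared mean; the other is at least `2 * D`.
          _ ≤ 4 * (4 ^ r * O) / (q ^ j * (2 * D)) := by
              gcongr
          _ = _ := by
              field_simp
              ring
      · simp only [if_neg hlarge, mul_zero, Finset.sum_const_zero]
        positivity
    refine (Finset.sum_le_sum hv).trans ?_
    rw [← Finset.mul_sum, div_mul_eq_mul_div, div_le_iff₀ (by positivity)]
    have hS : ∑ v ∈ C, (((overlapPairs E h).filter fun p => v ∈ h p.1 ∩ h p.2).card : ℝ) ≤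
        r * (overlapPairs E h).card := by exact_mod_cast sum_card_overlapPairs_le E h hr C
    calc _ ≤ 2 * 4 ^ r * (r * ((overlapPairs E h).card : ℝ)) := by gcongr
      _ ≤ _ := by linarith
  have hcard : ∑ T ∈ J.powerset, binomWeight q J T * (T.card : ℝ) ≤ q * Fintype.card X := by
    rw [sum_binomWeight_mul_card_self]
    have : (J.card : ℝ) ≤ Fintype.card X := by exact_mod_cast Finset.card_le_univ J
    gcongr
  -- Each quantity is divided by twice the bound on its mean, so the sum has mean at most 1 and one
  -- `T` serves both.
  obtain ⟨T, hTJ, hT⟩ := exists_subset_le_of_sum_binomWeight_le hq0.le hq1 J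
    (fun T => (T.card : ℝ) / (2 * q * Fintype.card X) + bad T / (2 * B)) 1 (by
      have : ∀ T, binomWeight q J T *
          ((T.card : ℝ) / (2 * q * Fintype.card X) + bad T / (2 * B)) =
          binomWeight q J T * (T.card : ℝ) * (1 / (2 * q * Fintype.card X)) +
            binomWeight q J T * bad T * (1 / (2 * B)) := fun T => by ring
      simp_rw [this]
      rw [Finset.sum_add_distrib, ← Finset.sum_mul, ← Finset.sum_mul]
      calc _ ≤ q * Fintype.card X * (1 / (2 * q * Fintype.card X)) + B * (1 / (2 * B)) := by
            gcongr
        _ = 1 := by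
            field_simp
            norm_num)
  refine ⟨T, hTJ, ?_, ?_⟩
  · have h1 : (T.card : ℝ) / (2 * q * Fintype.card X) ≤ 1 := by
      have : 0 ≤ bad T / (2 * B) := div_nonneg (hbad0 T) (by positivity)
      linarith
    rwa [div_le_one (by positivity)] at h1
  · have h1 : bad T / (2 * B) ≤ 1 := by
      have : 0 ≤ (T.card : ℝ) / (2 * q * Fintype.card X) := by positivity
      linarith
    rw [div_le_one (by positivity)] at h1
    have h2 : ∑ v ∈ C, (if ((linkPairs E h C T j v).card : ℝ) ≤ D then
        ((linkPairs E h C J j v).card : ℝ) else 0) ≤ ∑ _v ∈ C, 2 * D / q ^ j + bad T := by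
      rw [← Finset.sum_add_distrib]
      refine Finset.sum_le_sum fun v _ => ?_
      have hnn : 0 ≤ 2 * D / q ^ j := by positivity
      by_cases hlarge : 2 * D < q ^ j * (linkPairs E h C J j v).card
      · rw [if_pos hlarge]
        linarith
      · rw [if_neg hlarge, add_zero]
        split_ifs
        · rw [le_div_iff₀ hqj]
          linarith
        · exact hnn
    refine h2.trans (add_le_add ?_ h1)
    rw [Finset.sum_const, nsmul_eq_mul, mul_comm]
    have : (C.card : ℝ) ≤ Fintype.card X := by exact_mod_cast Finset.card_le_univ C
    gcongr

end Step

/-- One step of the container construction: if few edges inside `C` have more than `j` elements in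
`J`, then `C` can be pruned, using two small fingerprints, such that few edges of what is left have
at least `j` elements in `J`. -/
lemma exists_pruned {r j : ℕ} (hj : j < r) {δ η : ℝ} (hδ : 0 < δ) (hδ1 : δ ≤ 1) (hη : 0 < η) :
    ∃ η' > 0, ∃ γ > 0, ∀ {X : Type u} {ι : Type v} [DecidableEq X] [Fintype X] (E : Finset ι)
      (h : ι → Finset X), E.Nonempty → (∀ e ∈ E, (h e).card = r) →
      ((overlapPairs E h).card : ℝ) * Fintype.card X ≤ γ * (E.card : ℝ) ^ 2 →
      ∃ D : ℝ, ∀ C J : Finset X, J ⊆ C →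
        ((richEdges E h C J (j + 1)).card : ℝ) ≤ η' * E.card →
        ∃ T S : Finset X, (T.card : ℝ) ≤ δ * Fintype.card X ∧ (S.card : ℝ) ≤ δ * Fintype.card X ∧
          J ⊆ pruned E h j D C T S ∧
          ((richEdges E h (pruned E h j D C T S) J j).card : ℝ) ≤ η * E.card := by
  have hr0 : (0 : ℝ) < r := by exact_mod_cast (Nat.zero_le j).trans_lt hj
  set q : ℝ := δ / 2 with hq
  have hq0 : 0 < q := by positivity
  have hq1 : q ≤ 1 := by linarith
  set θ : ℝ := η / 8 with hθ
  have hθ0 : 0 < θ := by positivity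
  have hqj : 0 < q ^ j := pow_pos hq0 j
  set R : ℝ := r * 2 ^ r with hR
  have hR0 : 0 < R := by positivity
  -- In the minimum, the first term bounds the degrees carried by `S`, the second the size of `S`.
  -- The value of `γ` makes the expected bad mass at most `η / 4` of the edges.
  refine ⟨min (η / (4 * R)) (δ * (θ * q ^ j) / R), by positivity,
    η / 4 * (q ^ j * (θ * q ^ j)) / (2 * 4 ^ r * r), by positivity, ?_⟩
  intro X ι _ _ E h hE hr hO
  have he0 : (0 : ℝ) < E.card := by exact_mod_cast hE.card_pos
  have hX : 0 < Fintype.card X := by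
    obtain ⟨e, he⟩ := hE
    have := Finset.card_le_univ (h e)
    rw [hr e he] at this
    omega
  have hX' : (0 : ℝ) < Fintype.card X := by exact_mod_cast hX
  set m : ℝ := (Fintype.card X : ℝ) with hm
  set n : ℝ := (E.card : ℝ) with hn
  -- The threshold is fixed before `C` and `J`, so the pruned set depends on `J` only through the
  -- fingerprints.
  refine ⟨θ * q ^ j * n / m, ?_⟩
  intro C J hJC hrich
  have hD : 0 < θ * q ^ j * n / m := by positivity
  set D : ℝ := θ * q ^ j * n / m with hDdef
  have hO' : 2 * 4 ^ r * r * ((overlapPairs E h).card : ℝ) ≤ η / 4 * n * (q ^ j * D) := by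
    rw [div_mul_eq_mul_div, le_div_iff₀ (by positivity)] at hO
    rw [hDdef, mul_div_assoc', mul_div_assoc', le_div_iff₀ hX']
    linarith
  obtain ⟨T, hTJ, hT, hlow⟩ := exists_sparse_subset E h hr hq0 hq1 hD
    (B := η / 4 * n) (by positivity) hO' C J hX
  have htouch : ∑ v ∈ J, ((linkPairs E h C J j v).card : ℝ) ≤
      R * ((richEdges E h C J (j + 1)).card : ℝ) := by
    rw [hR]
    exact_mod_cast sum_card_linkPairs_le E h hr C J j
  -- The elements of `J` that pruning would otherwise delete.
  set S : Finset X := J.filter fun v => D < ((linkPairs E h C T j v).card : ℝ) with hS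
  have hSJ : S ⊆ J := Finset.filter_subset _ _
  refine ⟨T, S, ?_, ?_, ?_, ?_⟩
  · rw [hq] at hT
    linarith
  · have h1 : (S.card : ℝ) * D ≤ ∑ v ∈ J, ((linkPairs E h C J j v).card : ℝ) := by
      rw [← nsmul_eq_mul]
      refine (Finset.card_nsmul_le_sum S (fun v => ((linkPairs E h C J j v).card : ℝ)) D
        fun v hv => ?_).trans (Finset.sum_le_sum_of_subset_of_nonneg hSJ fun _ _ _ => by positivity)
      refine (Finset.mem_filter.1 hv).2.le.trans ?_
      exact_mod_cast card_linkPairs_mono E h hTJ j v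
    have h2 : R * ((richEdges E h C J (j + 1)).card : ℝ) ≤ δ * (θ * q ^ j) * n := by
      have := hrich.trans (mul_le_mul_of_nonneg_right (min_le_right _ _) he0.le)
      rw [div_mul_eq_mul_div, le_div_iff₀ hR0] at this
      linarith
    have h3 : (S.card : ℝ) * D ≤ δ * m * D := by
      have : δ * m * D = δ * (θ * q ^ j) * n := by
        rw [hDdef]
        field_simp
      linarith
    exact le_of_mul_le_mul_right h3 hD
  · intro v hv
    rw [pruned, Finset.mem_filter]
    refine ⟨hJC hv, ?_⟩
    by_cases hvD : ((linkPairs E h C T j v).card : ℝ) ≤ D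
    · exact Or.inl hvD
    · exact Or.inr (Finset.mem_filter.2 ⟨hv, not_le.1 hvD⟩)
  · have h1 : ((richEdges E h (pruned E h j D C T S) J j).card : ℝ) ≤
        ∑ v ∈ pruned E h j D C T S, ((linkPairs E h C J j v).card : ℝ) := by
      exact_mod_cast card_richEdges_le E h hr hj (Finset.filter_subset _ _) J
    -- Low degree vertices contribute at most `η / 4 + η / 2` of the edges and `S` at most `η / 4`.
    have h2 : ∑ v ∈ pruned E h j D C T S, ((linkPairs E h C J j v).card : ℝ) ≤
        ∑ v ∈ C, (if ((linkPairs E h C T j v).card : ℝ) ≤ D then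
          ((linkPairs E h C J j v).card : ℝ) else 0) +
        ∑ v ∈ S, ((linkPairs E h C J j v).card : ℝ) := by
      rw [← Finset.sum_filter]
      refine (Finset.sum_le_sum_of_subset_of_nonneg (t := (C.filter fun v =>
        ((linkPairs E h C T j v).card : ℝ) ≤ D) ∪ S) ?_ fun _ _ _ => by positivity).trans ?_
      · intro v hv
        rw [pruned, Finset.mem_filter] at hv
        rw [Finset.mem_union, Finset.mem_filter]
        tauto
      · rw [← Finset.sum_union_inter]
        exact le_add_of_nonneg_right (Finset.sum_nonneg fun _ _ => by positivity)
    have h3 : ∑ v ∈ S, ((linkPairs E h C J j v).card : ℝ) ≤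
        R * ((richEdges E h C J (j + 1)).card : ℝ) :=
      (Finset.sum_le_sum_of_subset_of_nonneg hSJ fun _ _ _ => by positivity).trans htouch
    have h4 : R * ((richEdges E h C J (j + 1)).card : ℝ) ≤ η / 4 * n := by
      have := hrich.trans (mul_le_mul_of_nonneg_right (min_le_left _ _) he0.le)
      rw [div_mul_eq_mul_div, le_div_iff₀ (by positivity)] at this
      linarith
    have h5 : 2 * D / q ^ j * m = η / 4 * n := by
      rw [hDdef, hθ]
      field_simp
      norm_num
    linarith

/-! ### The container theorem -/

/-- Containers for hypergraphs with few overlapping pairs of edges: the independent sets are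
covered by a family of sets, at most one for each tuple of `2 * k` small fingerprints, in which few
edges have at least `r - k` elements in the independent set. -/
lemma exists_containers_of_level (r : ℕ) {δ : ℝ} (hδ : 0 < δ) (hδ1 : δ ≤ 1) (k : ℕ) (hk : k ≤ r)
    {η : ℝ} (hη : 0 < η) :
    ∃ γ > 0, ∀ {X : Type u} {ι : Type v} [DecidableEq X] [Fintype X] (E : Finset ι)
      (h : ι → Finset X), E.Nonempty → (∀ e ∈ E, (h e).card = r) →
      ((overlapPairs E h).card : ℝ) * Fintype.card X ≤ γ * (E.card : ℝ) ^ 2 →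
      ∃ 𝒞 : Finset (Finset X),
        𝒞.card ≤ ((Finset.univ.filter fun S : Finset X =>
          (S.card : ℝ) ≤ δ * Fintype.card X).card) ^ (2 * k) ∧
        ∀ J : Finset X, (∀ e ∈ E, ¬ h e ⊆ J) → ∃ C ∈ 𝒞, J ⊆ C ∧
          ((richEdges E h C J (r - k)).card : ℝ) ≤ η * E.card := by
  induction k generalizing η with
  | zero =>
    refine ⟨1, one_pos, ?_⟩
    intro X ι _ _ E h _ hr _
    refine ⟨{Finset.univ}, by simp, fun J hJ => ⟨Finset.univ, by simp, Finset.subset_univ _, ?_⟩⟩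
    have : richEdges E h Finset.univ J (r - 0) = ∅ := by
      refine Finset.filter_eq_empty_iff.2 fun e he hc => hJ e he ?_
      have := Finset.eq_of_subset_of_card_le (Finset.inter_subset_left (s₁ := h e) (s₂ := J))
        (by rw [hr e he]; exact hc.2)
      exact Finset.inter_eq_left.1 this
    rw [this]
    simp only [Finset.card_empty, Nat.cast_zero]
    positivity
  | succ k ih =>
    obtain ⟨η', hη', γ₁, hγ₁, hstep⟩ :=
      exists_pruned.{u, v} (r := r) (j := r - (k + 1)) (by omega) hδ hδ1 hη
    obtain ⟨γ₂, hγ₂, hprev⟩ := ih (by omega) hη'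
    refine ⟨min γ₁ γ₂, lt_min hγ₁ hγ₂, ?_⟩
    intro X ι _ _ E h hE hr hO
    obtain ⟨D, hD⟩ := hstep E h hE hr (hO.trans (by gcongr; exact min_le_left _ _))
    obtain ⟨𝒞, hcard, hcov⟩ := hprev E h hE hr (hO.trans (by gcongr; exact min_le_right _ _))
    set 𝒮 : Finset (Finset X) := Finset.univ.filter fun S : Finset X =>
      (S.card : ℝ) ≤ δ * Fintype.card X with h𝒮
    -- Two new fingerprints per level account for the exponent `2 * k`.
    refine ⟨(𝒞 ×ˢ 𝒮 ×ˢ 𝒮).image fun p => pruned E h (r - (k + 1)) D p.1 p.2.1 p.2.2, ?_, ?_⟩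
    · refine Finset.card_image_le.trans ?_
      rw [Finset.card_product, Finset.card_product]
      calc _ ≤ 𝒮.card ^ (2 * k) * (𝒮.card * 𝒮.card) := Nat.mul_le_mul_right _ hcard
        _ = _ := by ring
    · intro J hJ
      obtain ⟨C, hC, hJC, hCrich⟩ := hcov J hJ
      rw [show r - k = r - (k + 1) + 1 by omega] at hCrich
      obtain ⟨T, S, hT, hS, hJ', hfin⟩ := hD C J hJC hCrich
      refine ⟨_, Finset.mem_image_of_mem _ (a := (C, T, S)) ?_, hJ', hfin⟩
      simp [h𝒮, hC, hT, hS]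

/-- The number of small subsets is subexponential. -/
lemma exists_card_small_subsets_le {ε : ℝ} (hε : 0 < ε) :
    ∃ δ : ℝ, 0 < δ ∧ δ ≤ 1 ∧ ∀ {X : Type u} [Fintype X],
      (((Finset.univ.filter fun S : Finset X => (S.card : ℝ) ≤ δ * Fintype.card X).card : ℕ) : ℝ) ≤
        Real.exp (ε * Fintype.card X) := by
  -- Each set `S` gets weight `x ^ |S|` with `x = exp (-L)`. Undoing the weight costs `δ * L ≤ ε /
  -- 2` per element, and the total weight costs `x ≤ ε / 2`.
  set L : ℝ := max 1 (-Real.log (ε / 2)) with hL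
  have hL1 : 1 ≤ L := le_max_left _ _
  refine ⟨min 1 (ε / (2 * L)), by positivity, min_le_left _ _, ?_⟩
  intro X _
  set δ : ℝ := min 1 (ε / (2 * L))
  have hδL : δ * L ≤ ε / 2 := by
    have : δ ≤ ε / (2 * L) := min_le_right _ _
    rw [le_div_iff₀ (by positivity)] at this
    linarith
  set m : ℝ := (Fintype.card X : ℝ) with hm
  set x : ℝ := Real.exp (-L) with hx
  have hx2 : x ≤ ε / 2 := by
    rw [hx, ← Real.exp_log (show 0 < ε / 2 by positivity), Real.exp_le_exp]
    have : -Real.log (ε / 2) ≤ L := le_max_right _ _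
    linarith
  have hsum : ∑ S : Finset X, x ^ S.card = (x + 1) ^ (Fintype.card X) := by
    have := Finset.sum_pow_mul_eq_add_pow x 1 (Finset.univ : Finset X)
    simpa using this
  calc (((Finset.univ.filter fun S : Finset X => (S.card : ℝ) ≤ δ * m).card : ℕ) : ℝ)
      = ∑ S ∈ Finset.univ.filter (fun S : Finset X => (S.card : ℝ) ≤ δ * m), (1 : ℝ) := by simp
    _ ≤ ∑ S ∈ Finset.univ.filter (fun S : Finset X => (S.card : ℝ) ≤ δ * m),
          Real.exp (δ * m * L) * x ^ S.card := by
        refine Finset.sum_le_sum fun S hS => ?_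
        rw [Finset.mem_filter] at hS
        rw [hx, ← Real.exp_nat_mul, ← Real.exp_add]
        refine Real.one_le_exp ?_
        nlinarith [hS.2]
    _ ≤ ∑ S : Finset X, Real.exp (δ * m * L) * x ^ S.card :=
        Finset.sum_le_sum_of_subset_of_nonneg (Finset.filter_subset _ _)
          fun _ _ _ => by positivity
    _ = Real.exp (δ * m * L) * (x + 1) ^ (Fintype.card X) := by rw [← Finset.mul_sum, hsum]
    _ ≤ Real.exp (δ * m * L) * Real.exp x ^ (Fintype.card X) := by
        gcongr
        exact Real.add_one_le_exp x
    _ = Real.exp (δ * L * m + x * m) := by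
        rw [← Real.exp_nat_mul, ← Real.exp_add, ← hm]
        ring_nf
    _ ≤ Real.exp (ε * m) := by
        rw [Real.exp_le_exp, ← add_mul]
        gcongr
        linarith

/-- The container theorem for uniform hypergraphs with few overlapping pairs of edges. -/
theorem exists_containers (r : ℕ) {ε η : ℝ} (hε : 0 < ε) (hη : 0 < η) :
    ∃ γ > 0, ∀ {X : Type u} {ι : Type v} [DecidableEq X] [Fintype X] (E : Finset ι)
      (h : ι → Finset X), E.Nonempty → (∀ e ∈ E, (h e).card = r) →
      ((overlapPairs E h).card : ℝ) * Fintype.card X ≤ γ * (E.card : ℝ) ^ 2 →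
      ∃ 𝒞 : Finset (Finset X),
        (𝒞.card : ℝ) ≤ Real.exp (ε * Fintype.card X) ∧
        (∀ C ∈ 𝒞, ((E.filter fun e => h e ⊆ C).card : ℝ) ≤ η * E.card) ∧
        ∀ J : Finset X, (∀ e ∈ E, ¬ h e ⊆ J) → ∃ C ∈ 𝒞, J ⊆ C := by
  have hr' : (0 : ℝ) < 2 * r + 1 := by positivity
  obtain ⟨δ, hδ, hδ1, hsmall⟩ := exists_card_small_subsets_le.{u} (div_pos hε hr')
  obtain ⟨γ, hγ, hmain⟩ := exists_containers_of_level.{u, v} r hδ hδ1 r le_rfl hη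
  refine ⟨γ, hγ, ?_⟩
  intro X ι _ _ E h hE hr hO
  obtain ⟨𝒞, hcard, hcov⟩ := hmain E h hE hr hO
  -- Only containers serving some independent set are known to be sparse; the rest are discarded.
  refine ⟨𝒞.filter fun C => ((E.filter fun e => h e ⊆ C).card : ℝ) ≤ η * E.card, ?_,
    fun C hC => (Finset.mem_filter.1 hC).2, ?_⟩
  · calc _ ≤ (𝒞.card : ℝ) := by exact_mod_cast Finset.card_filter_le _ _
      _ ≤ (((Finset.univ.filter fun S : Finset X =>
          (S.card : ℝ) ≤ δ * Fintype.card X).card : ℕ) : ℝ) ^ (2 * r) := by exact_mod_cast hcard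
      _ ≤ Real.exp (ε / (2 * r + 1) * Fintype.card X) ^ (2 * r) := by
        gcongr
        exact hsmall
      _ ≤ _ := by
        rw [← Real.exp_nat_mul, Real.exp_le_exp]
        push_cast
        rw [← mul_assoc]
        gcongr
        rw [mul_div_assoc', div_le_iff₀ hr']
        nlinarith
  · intro J hJ
    obtain ⟨C, hC, hJC, hrich⟩ := hcov J hJ
    refine ⟨C, Finset.mem_filter.2 ⟨hC, ?_⟩, hJC⟩
    simpa [richEdges] using hrich

/-! ### Interval colourings and template boxes -/

/-- Finitely many intervals are unions of classes of a finite partition into intervals. -/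
lemma exists_interval_colouring (𝒯 : Set (Set I)) (hfin : 𝒯.Finite)
    (hoc : ∀ J ∈ 𝒯, J.OrdConnected) :
    ∃ (K : Type) (_ : Fintype K) (κ : I → K), (∀ a, (κ ⁻¹' {a}).OrdConnected) ∧
      ∀ J ∈ 𝒯, ∀ x y, κ x = κ y → x ∈ J → y ∈ J := by
  classical
  have := hfin.fintype
  -- Inside, strictly below or above `J`: three intervals. The joint colour classes are
  -- intersections of such intervals.
  let side : Set I → I → Fin 3 := fun J x => if x ∈ J then 0 else if ∀ y ∈ J, x < y then 1 else 2
  refine ⟨𝒯 → Fin 3, inferInstance, fun x J => side J x, ?_, ?_⟩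
  · intro a
    refine ⟨fun x hx y hy z hz => ?_⟩
    rw [Set.mem_preimage, Set.mem_singleton_iff] at hx hy ⊢
    funext J
    have hJ := hoc J.1 J.2
    have hxy : side J.1 x = side J.1 y := by
      rw [show side J.1 x = a J from congrFun hx J, show side J.1 y = a J from congrFun hy J]
    rw [← congrFun hx J]
    change side J.1 z = side J.1 x
    by_cases hxJ : x ∈ J.1
    · have hyJ : y ∈ J.1 := by
        by_contra hyJ
        simp only [side, if_pos hxJ, if_neg hyJ] at hxy
        split_ifs at hxy
        all_goals exact absurd hxy (by decide)
      simp only [side, if_pos hxJ, if_pos (hJ.out hxJ hyJ hz)]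
    · have hyJ : y ∉ J.1 := by
        intro hyJ
        simp only [side, if_neg hxJ, if_pos hyJ] at hxy
        split_ifs at hxy
        all_goals exact absurd hxy (by decide)
      by_cases hxl : ∀ w ∈ J.1, x < w
      · have hyl : ∀ w ∈ J.1, y < w := by
          by_contra hyl
          simp only [side, if_neg hxJ, if_neg hyJ, if_pos hxl, if_neg hyl] at hxy
          exact absurd hxy (by decide)
        have hzl : ∀ w ∈ J.1, z < w := fun w hw => hz.2.trans_lt (hyl w hw)
        have hzJ : z ∉ J.1 := fun h => lt_irrefl _ (hzl z h)
        simp only [side, if_neg hxJ, if_neg hzJ, if_pos hxl, if_pos hzl]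
      · have hxl' := hxl
        push Not at hxl
        obtain ⟨w, hw, hwx⟩ := hxl
        have hzJ : z ∉ J.1 := fun h => hxJ (hJ.out hw h ⟨hwx, hz.1⟩)
        have hzl : ¬ ∀ w ∈ J.1, z < w := fun h => absurd (h w hw) (not_lt.2 (hwx.trans hz.1))
        simp only [side, if_neg hxJ, if_neg hzJ, if_neg hxl', if_neg hzl]
  · intro J hJ x y hxy hx
    have h1 : side J x = side J y := congrFun hxy ⟨J, hJ⟩
    by_contra hy
    simp only [side, if_pos hx, if_neg hy] at h1
    split_ifs at h1
    all_goals exact absurd h1 (by decide)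

/-- A finite union of simple boxes is determined by a finite partition into intervals. -/
lemma exists_colouring_of_simpleBoxes {V : Type u} [Finite V] (F : Finset (Set (V → I)))
    (hF : ∀ f ∈ F, IsSimpleBox f) :
    ∃ (K : Type) (_ : Fintype K) (κ : I → K), (∀ a, (κ ⁻¹' {a}).OrdConnected) ∧
      ∀ x y : V → I, (∀ v, κ (x v) = κ (y v)) → x ∈ ⋃ f ∈ F, f → y ∈ ⋃ f ∈ F, f := by
  have hT : ∀ (f : F) (v : V), ∃ T : Set (Set I), T.Finite ∧ (∀ J ∈ T, J.OrdConnected) ∧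
      (fun c : V → I => c v) '' f.1 = ⋃₀ T := fun f v => (hF f.1 f.2).2 v
  choose T hfin hoc hT using hT
  obtain ⟨K, hK, κ, hκ, hsat⟩ := exists_interval_colouring (⋃ f, ⋃ v, T f v)
    (Set.finite_iUnion fun f => Set.finite_iUnion fun v => hfin f v) (by
      intro J hJ
      simp only [Set.mem_iUnion] at hJ
      obtain ⟨f, v, hJ⟩ := hJ
      exact hoc f v J hJ)
  refine ⟨K, hK, κ, hκ, fun x y hxy hx => ?_⟩
  simp only [Set.mem_iUnion] at hx ⊢
  obtain ⟨f, hf, hx⟩ := hx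
  refine ⟨f, hf, ?_⟩
  obtain ⟨A, -, hA⟩ := (hF f hf).1
  rw [hA]
  intro v _
  have h1 : x v ∈ ⋃₀ T ⟨f, hf⟩ v := by
    rw [← hT]
    exact ⟨x, hx, rfl⟩
  obtain ⟨J, hJ, hxJ⟩ := h1
  have h2 : y v ∈ ⋃₀ T ⟨f, hf⟩ v := ⟨J, hJ, hsat J (by
    simp only [Set.mem_iUnion]
    exact ⟨_, _, hJ⟩) _ _ (hxy v) hxJ⟩
  rw [← hT] at h2
  obtain ⟨z, hz, hzv⟩ := h2
  rw [← hzv]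
  have hz' : z ∈ f := hz
  rw [hA] at hz'
  exact hz' v trivial

/-- The box of the points whose colours are allowed by the template `C`. -/
def templateBox {V : Type u} {K : Type} (κ : I → K) (C : Finset (V × K)) : Set (V → I) :=
  {y | ∀ v, (v, κ (y v)) ∈ C}

lemma isSimpleBox_templateBox {V : Type u} {K : Type} [Finite K] (κ : I → K)
    (hκ : ∀ a, (κ ⁻¹' {a}).OrdConnected) (C : Finset (V × K)) :
    IsSimpleBox (templateBox κ C) := by
  have hpi : templateBox κ C = Set.univ.pi fun v => {x | (v, κ x) ∈ C} := by
    ext y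
    simp [templateBox]
  have hunion : ∀ v, {x | (v, κ x) ∈ C} =
      ⋃₀ ((fun a => κ ⁻¹' {a}) '' {a | (v, a) ∈ C}) := by
    intro v
    ext x
    simp
  refine ⟨⟨fun v => {x | (v, κ x) ∈ C}, fun v => ?_, hpi⟩, fun v => ?_⟩
  · change MeasurableSet {x | (v, κ x) ∈ C}
    rw [hunion]
    refine MeasurableSet.sUnion ((Set.toFinite _).image _).countable ?_
    rintro _ ⟨a, -, rfl⟩
    exact (hκ a).measurableSet
  -- A nonempty product projects onto its factors; an empty one has empty projections whatever the
  -- factors are.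
  · rcases (templateBox κ C).eq_empty_or_nonempty with h | h
    · exact ⟨∅, Set.finite_empty, by simp, by simp [h]⟩
    · refine ⟨_, (Set.toFinite {a | (v, a) ∈ C}).image (fun a => κ ⁻¹' {a}), ?_, ?_⟩
      · rintro _ ⟨a, -, rfl⟩
        exact hκ a
      · rw [hpi] at h ⊢
        rw [← hunion v]
        exact Set.eval_image_univ_pi h

/-! ### The pattern hypergraph of a good ssee -/

/-- The edge of the pattern hypergraph given by an embedding and a colouring. -/
def patternEdge {V W : Type u} {K : Type} [Fintype V] (p : (V ↪ W) × (V → K)) : Finset (W × K) :=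
  Finset.univ.map ⟨fun i => (p.1 i, p.2 i), fun _ _ h => p.1.injective (Prod.ext_iff.1 h).1⟩

lemma card_patternEdge {V W : Type u} {K : Type} [Fintype V] (p : (V ↪ W) × (V → K)) :
    (patternEdge p).card = Fintype.card V := by
  simp [patternEdge]

lemma patternEdge_subset_iff {V W : Type u} {K : Type} [Fintype V] (p : (V ↪ W) × (V → K))
    (C : Finset (W × K)) : patternEdge p ⊆ C ↔ ∀ i, (p.1 i, p.2 i) ∈ C := by
  simp only [patternEdge, Finset.subset_iff, Finset.mem_map, Finset.mem_univ, true_and,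
    forall_exists_index, forall_apply_eq_imp_iff]
  rfl

/-- An edge has at most one vertex over each point of `W`, so the first projection is injective on
the intersection. -/
lemma card_patternEdge_inter_le {V W : Type u} {K : Type} [Fintype V] [DecidableEq (W × K)]
    (p p' : (V ↪ W) × (V → K)) :
    (patternEdge p ∩ patternEdge p').card ≤ (Set.range p.1 ∩ Set.range p'.1).ncard := by
  rw [← Set.ncard_coe_finset]
  refine Set.ncard_le_ncard_of_injOn Prod.fst ?_ ?_ (Set.toFinite _)
  · intro x hx
    simp only [patternEdge, Finset.coe_inter, Finset.coe_map, Set.mem_inter_iff, Set.mem_image] at hx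
    obtain ⟨⟨i, -, rfl⟩, ⟨i', -, h⟩⟩ := hx
    exact ⟨⟨i, rfl⟩, ⟨i', (Prod.ext_iff.1 h).1⟩⟩
  · intro x hx y hy hxy
    simp only [patternEdge, Finset.coe_inter, Finset.coe_map, Set.mem_inter_iff, Set.mem_image] at hx hy
    obtain ⟨⟨i, -, rfl⟩, -⟩ := hx
    obtain ⟨⟨i', -, rfl⟩, -⟩ := hy
    obtain rfl : i = i' := p.1.injective hxy
    rfl

/-- At most `|V|^|V|` embeddings of `V` have their image inside that of a given one. -/
lemma card_filter_range_subset_le {V W : Type u} [Fintype V] (A : Finset (V ↪ W)) (φ : V ↪ W)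
    [DecidablePred fun ψ : V ↪ W => Set.range ψ ⊆ Set.range φ] :
    (A.filter fun ψ : V ↪ W => Set.range ψ ⊆ Set.range φ).card ≤
      Fintype.card V ^ Fintype.card V := by
  classical
  rw [← Fintype.card_fun, ← Finset.card_univ]
  -- Such a `ψ` factors as `φ ∘ g`, and `g` determines it.
  have hex : ∀ ψ : V ↪ W, ∃ g : V → V, Set.range ψ ⊆ Set.range φ → ∀ i, φ (g i) = ψ i := by
    intro ψ
    by_cases h : Set.range ψ ⊆ Set.range φ
    · choose g hg using fun i => h ⟨i, rfl⟩
      exact ⟨g, fun _ => hg⟩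
    · exact ⟨id, fun h' => absurd h' h⟩
  choose g hg using hex
  refine Finset.card_le_card_of_injOn g (fun _ _ => Finset.mem_coe.2 (Finset.mem_univ _)) ?_
  intro ψ hψ ψ' hψ' h
  have h1 := hg ψ (Finset.mem_filter.1 hψ).2
  have h2 := hg ψ' (Finset.mem_filter.1 hψ').2
  ext i
  rw [← h1, ← h2, h]

namespace SSEE

-- `overlap` omits the pairs with equal images; these are few, since an image determines its
-- embedding up to a self-map of `V N`.
open Classical in
lemma card_intersecting_embeddings_le (S : SSEE.{u}) (N n : ℕ) :
    (((S.emb N n) ×ˢ (S.emb N n)).filter fun p =>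
        2 ≤ (Set.range p.1 ∩ Set.range p.2).ncard).card ≤
      S.overlap N n +
        Fintype.card (S.V N) ^ Fintype.card (S.V N) * (S.emb N n).card := by
  set r := Fintype.card (S.V N) with hr
  set P := (S.emb N n) ×ˢ (S.emb N n)
  let c : (S.V N ↪ S.V n) × (S.V N ↪ S.V n) → ℕ := fun p =>
    (Set.range p.1 ∩ Set.range p.2).ncard
  have hsub : P.filter (fun p => 2 ≤ c p) ⊆
      P.filter (fun p => c p ∈ Finset.Ioo 1 r) ∪
        P.filter (fun p => Set.range p.2 ⊆ Set.range p.1) := by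
    intro p hp
    rw [Finset.mem_filter] at hp
    rw [Finset.mem_union, Finset.mem_filter, Finset.mem_filter, Finset.mem_Ioo]
    by_cases hc : c p < r
    · exact Or.inl ⟨hp.1, by omega, hc⟩
    · refine Or.inr ⟨hp.1, ?_⟩
      have hcard : (Set.range p.2).ncard = r := by
        rw [hr, ← Nat.card_eq_fintype_card, ← Set.ncard_univ, ← Set.image_univ,
          Set.ncard_image_of_injective _ p.2.injective]
      have := Set.eq_of_subset_of_ncard_le
        (Set.inter_subset_right (s := Set.range p.1) (t := Set.range p.2))
        (by rw [hcard]; exact not_lt.1 hc) (Set.toFinite _)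
      exact Set.inter_eq_right.1 this
  refine (Finset.card_le_card hsub).trans ((Finset.card_union_le _ _).trans
    (add_le_add (le_of_eq ?_) ?_))
  · rw [overlap, Finset.card_eq_sum_card_fiberwise (f := c) (t := Finset.Ioo 1 r)
      (fun p hp => Finset.mem_coe.2 (Finset.mem_filter.1 hp).2)]
    refine Finset.sum_congr rfl fun i hi => ?_
    rw [numIntersecting, ← Set.ncard_coe_finset]
    congr 1
    ext p
    simp only [Finset.coe_filter, Finset.mem_filter, Finset.mem_product, P, c, Set.mem_ofPred_eq]
    constructor
    · rintro ⟨⟨⟨h1, h2⟩, -⟩, h3⟩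
      exact ⟨h1, h2, h3⟩
    · rintro ⟨h1, h2, h3⟩
      exact ⟨⟨⟨h1, h2⟩, by rw [h3]; exact hi⟩, h3⟩
  · rw [Finset.card_filter, Finset.sum_product, mul_comm, ← smul_eq_mul]
    refine Finset.sum_le_card_nsmul _ _ _ fun φ _ => ?_
    rw [← Finset.card_filter]
    exact card_filter_range_subset_le _ φ

open Classical in
lemma card_overlapPairs_le (S : SSEE.{u}) (N n : ℕ) {K : Type} (B : Finset (S.V N → K)) :
    (overlapPairs (S.emb N n ×ˢ B) patternEdge).card ≤
      (((S.emb N n) ×ˢ (S.emb N n)).filter fun p =>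
        2 ≤ (Set.range p.1 ∩ Set.range p.2).ncard).card * (B.card * B.card) := by
  rw [← Finset.card_product B B, ← Finset.card_product]
  refine Finset.card_le_card_of_injOn (fun p => ((p.1.1, p.2.1), (p.1.2, p.2.2))) ?_ ?_
  · intro p hp
    simp only [overlapPairs, Finset.coe_filter, Finset.mem_product, Set.mem_ofPred_eq] at hp
    simp only [Finset.coe_product, Set.mem_prod, Finset.mem_coe, Finset.mem_filter,
      Finset.mem_product]
    exact ⟨⟨⟨hp.1.1.1, hp.1.2.1⟩, hp.2.trans (card_patternEdge_inter_le _ _)⟩,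
      hp.1.1.2, hp.1.2.2⟩
  · rintro ⟨⟨a, b⟩, c, d⟩ - ⟨⟨a', b'⟩, c', d'⟩ - h
    simp only [Prod.mk.injEq] at h ⊢
    tauto

open Classical in
/-- In a good ssee, the pattern hypergraphs have few overlapping pairs of edges. -/
lemma IsGood.eventually_overlapPairs_le {S : SSEE.{u}} (hS : S.IsGood) (N : ℕ) {K : Type}
    [Fintype K] (B : Finset (S.V N → K)) {γ : ℝ} (hγ : 0 < γ) :
    ∀ᶠ n in atTop, ((overlapPairs (S.emb N n ×ˢ B) patternEdge).card : ℝ) *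
      Fintype.card (S.V n × K) ≤ γ * ((S.emb N n ×ˢ B).card : ℝ) ^ 2 := by
  by_cases hr : 1 < Fintype.card (S.V N)
  · set r := Fintype.card (S.V N)
    set k : ℝ := (Fintype.card K : ℝ)
    have hk : 0 ≤ k := Nat.cast_nonneg _
    -- Pairs with equal images and pairs counted by `overlap` each get half of `γ`; `k + 1` guards
    -- against an empty `K`.
    have h1 := (hS.many_embeddings N hr).eventually_ge_atTop (2 * (r : ℝ) ^ r * k / γ)
    have h2 := (hS.many_embeddings N hr).eventually_gt_atTop 0
    have h3 := (hS.small_overlap N hr).eventually_le_const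
      (show (0 : ℝ) < γ / (2 * (k + 1)) by positivity)
    filter_upwards [h1, h2, h3] with n h1 h2 h3
    set a : ℝ := ((S.emb N n).card : ℝ)
    set m : ℝ := (Fintype.card (S.V n) : ℝ) with hm
    have hm0 : 0 < m := by
      rcases (Nat.cast_nonneg (α := ℝ) (Fintype.card (S.V n))).eq_or_lt with h | h
      · rw [hm, ← h, div_zero] at h2
        exact absurd h2 (lt_irrefl _)
      · exact h
    have ha0 : 0 < a := by
      have := mul_pos h2 hm0
      rwa [div_mul_cancel₀ _ hm0.ne'] at this
    have hb : (0 : ℝ) ≤ B.card := Nat.cast_nonneg _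
    have ho : (0 : ℝ) ≤ S.overlap N n := Nat.cast_nonneg _
    have hcount : ((overlapPairs (S.emb N n ×ˢ B) patternEdge).card : ℝ) ≤
        (S.overlap N n + (r : ℝ) ^ r * a) * (B.card * B.card) := by
      have h := (Nat.cast_le (α := ℝ)).2 ((S.card_overlapPairs_le N n B).trans
        (Nat.mul_le_mul_right _ (S.card_intersecting_embeddings_le N n)))
      push_cast at h
      exact h
    rw [le_div_iff₀ hm0, div_mul_eq_mul_div, div_le_iff₀ hγ] at h1
    rw [div_le_iff₀ (by positivity), div_mul_eq_mul_div, le_div_iff₀ (by positivity)] at h3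
    have h4 : (S.overlap N n + (r : ℝ) ^ r * a) * (m * k) ≤ γ * a ^ 2 := by
      have h5 : m * S.overlap N n * k ≤ m * S.overlap N n * (k + 1) := by gcongr; linarith
      have h6 := mul_le_mul_of_nonneg_left h1 ha0.le
      nlinarith
    rw [Fintype.card_prod, Finset.card_product]
    push_cast
    calc _ ≤ (S.overlap N n + (r : ℝ) ^ r * a) * (B.card * B.card) * (m * k) := by gcongr
      _ = (S.overlap N n + (r : ℝ) ^ r * a) * (m * k) * (B.card * B.card) := by ring
      _ ≤ γ * a ^ 2 * (B.card * B.card) := by gcongr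
      _ = _ := by ring
  -- Edges with at most one vertex never share two; goodness is not needed here.
  · refine Eventually.of_forall fun n => ?_
    have : overlapPairs (S.emb N n ×ˢ B) patternEdge = ∅ := by
      refine Finset.filter_eq_empty_iff.2 fun p _ hp => hr ?_
      rw [← card_patternEdge p.1]
      exact hp.trans (Finset.card_le_card Finset.inter_subset_left)
    rw [this]
    simp only [Finset.card_empty, Nat.cast_zero, zero_mul]
    positivity

end SSEE

/-! ### From containers to boxes -/

lemma mem_of_mem_projDown {V W : Type u} [Fintype W] {φ : V ↪ W} {c : Set (W → I)} {x : V → I}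
    (hx : x ∈ projDown φ c) : ∃ y ∈ c, ∀ v, y (φ v) = x v := by
  rw [projDown, Set.mem_ofPred_eq] at hx
  obtain ⟨d, y, hy, hyx, -⟩ := nonempty_of_measure_ne_zero hx.ne'
  exact ⟨y, hy, hyx⟩

open Classical in
/-- The density of forbidden patterns in a template box is at most their number. -/
lemma volume_real_projDown_templateBox_le {V W : Type u} [Fintype V] [Fintype W] {K : Type}
    (κ : I → K) (C : Finset (W × K)) (φ : V ↪ W) (b : Set (V → I)) (B : Finset (V → K))
    (hB : ∀ x ∈ b, κ ∘ x ∈ B) :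
    (volume : Measure (V → I)).real (projDown φ (templateBox κ C) ∩ b) ≤
      ((B.filter fun f => patternEdge (φ, f) ⊆ C).card : ℝ) := by
  rcases (projDown φ (templateBox κ C) ∩ b).eq_empty_or_nonempty with h | ⟨x, hx, hxb⟩
  · rw [h, measureReal_empty]
    positivity
  -- The volume is at most 1, so it is enough that a point of the intersection yields one pattern.
  · have h1 : 0 < (B.filter fun f => patternEdge (φ, f) ⊆ C).card := by
      refine Finset.card_pos.2 ⟨κ ∘ x, Finset.mem_filter.2 ⟨hB x hxb, ?_⟩⟩
      rw [patternEdge_subset_iff]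
      intro i
      obtain ⟨y, hy, hyx⟩ := mem_of_mem_projDown hx
      have := hy (φ i)
      rwa [hyx i] at this
    refine measureReal_le_one.trans ?_
    exact_mod_cast h1

lemma isSimpleBox_univ {V : Type u} : IsSimpleBox (Set.univ : Set (V → I)) := by
  refine ⟨⟨fun _ => Set.univ, fun _ => MeasurableSet.univ, by simp⟩, fun v => ?_⟩
  refine ⟨{Set.univ}, Set.finite_singleton _, ?_, ?_⟩
  · rintro _ rfl
    exact Set.ordConnected_univ
  · rw [Set.sUnion_singleton, Set.image_univ]
    exact Set.range_eq_univ.2 fun x => ⟨fun _ => x, rfl⟩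

theorem mainTheorem4 (S : SSEE.{u}) (hS : S.IsGood) (N : ℕ)
    (F : Finset (Set (S.V N → I))) (hF : F.Nonempty) (hFbox : ∀ f ∈ F, IsSimpleBox f)
    (b : Set (S.V N → I)) (hb : b = ⋃ f ∈ F, f) (ε : ℝ) (hε : 0 < ε) :
    ∃ n₀ : ℕ, 0 < n₀ ∧ N ≤ n₀ ∧ ∀ n ≥ n₀,
      ∃ C : Finset (Set (S.V n → I)),
        (∀ c ∈ C, IsSimpleBox c) ∧
        S.Forb b n ⊆ ⋃ c ∈ C, c ∧
        (∀ c ∈ C,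
          (𝔼 φ ∈ S.emb N n, (volume : Measure (S.V N → I)).real (projDown φ c ∩ b)) < ε) ∧
        (C.card : ℝ) ≤ Real.exp (ε * (Fintype.card (S.V n) : ℝ)) := by
  classical
  obtain ⟨K, _, κ, hκ, hsat⟩ := exists_colouring_of_simpleBoxes F hFbox
  rw [← hb] at hsat
  set B : Finset (S.V N → K) := Finset.univ.filter fun f => ∃ x ∈ b, κ ∘ x = f with hBdef
  have hB : ∀ x ∈ b, κ ∘ x ∈ B := fun x hx => Finset.mem_filter.2 ⟨Finset.mem_univ _, x, hx, rfl⟩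
  -- The vertex set has `|K| * |V n|` elements and each embedding carries `|B|` edges; the constants
  -- absorb these factors.
  obtain ⟨γ, hγ, hcont⟩ := exists_containers.{u, u} (Fintype.card (S.V N))
    (ε := ε / (Fintype.card K + 1)) (η := ε / (2 * (B.card + 1))) (by positivity) (by positivity)
  obtain ⟨n₀, hn₀⟩ := eventually_atTop.1 (hS.eventually_overlapPairs_le N B hγ)
  refine ⟨max n₀ (N + 1), by positivity, by omega, fun n hn => ?_⟩
  have hO := hn₀ n (by omega)
  -- Without edges the whole cube works: either there are no embeddings and the average is 0, or `b`
  -- is empty.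
  rcases (S.emb N n ×ˢ B).eq_empty_or_nonempty with hE | hE
  · refine ⟨{Set.univ}, by simpa using isSimpleBox_univ, by simp, ?_, ?_⟩
    · rintro c -
      refine lt_of_eq_of_lt ?_ hε
      refine Finset.expect_eq_zero fun φ hφ => ?_
      have hB0 : B = ∅ := (Finset.product_eq_empty.1 hE).resolve_left (Finset.ne_empty_of_mem hφ)
      have hb0 : b = ∅ := Set.eq_empty_of_forall_notMem fun x hx => by simpa [hB0] using hB x hx
      rw [hb0, Set.inter_empty, measureReal_empty]
    · rw [Finset.card_singleton, Nat.cast_one]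
      exact Real.one_le_exp (by positivity)
  · obtain ⟨𝒞, hcard, hsparse, hcov⟩ := hcont (S.emb N n ×ˢ B) patternEdge hE
      (fun e _ => card_patternEdge e) hO
    refine ⟨𝒞.image (templateBox κ), ?_, ?_, ?_, ?_⟩
    · intro c hc
      obtain ⟨C, -, rfl⟩ := Finset.mem_image.1 hc
      exact isSimpleBox_templateBox κ hκ C
    · intro y hy
      -- An edge inside the graph of `κ ∘ y` would give `y ∘ φ` the colours of a point of `b`, hence
      -- put it in `b`.
      obtain ⟨C, hC, hyC⟩ := hcov (Finset.univ.image fun v => (v, κ (y v))) (by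
        intro e he hsub
        rw [patternEdge_subset_iff] at hsub
        rw [Finset.mem_product] at he
        obtain ⟨x, hx, hxe⟩ := (Finset.mem_filter.1 he.2).2
        refine hy ?_
        rw [SSEE.upperShadow]
        refine Set.mem_biUnion (Finset.mem_coe.2 he.1) ⟨fun i => y (e.1 i), ?_, fun _ => rfl⟩
        refine hsat x _ (fun i => ?_) hx
        have h1 := hsub i
        rw [← hxe, Finset.mem_image] at h1
        obtain ⟨v, -, hv⟩ := h1
        rw [Prod.mk.injEq] at hv
        rw [← hv.1]
        exact hv.2.symm)
      refine Set.mem_biUnion (Finset.mem_coe.2 (Finset.mem_image_of_mem _ hC)) fun v => ?_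
      exact hyC (Finset.mem_image_of_mem _ (Finset.mem_univ v))
    · intro c hc
      obtain ⟨C, hC, rfl⟩ := Finset.mem_image.1 hc
      have ha : (0 : ℝ) < (S.emb N n).card := by
        exact_mod_cast (Finset.nonempty_product.1 hE).1.card_pos
      rw [Finset.expect_eq_sum_div_card, div_lt_iff₀ ha]
      have hsum : ((((S.emb N n) ×ˢ B).filter fun e => patternEdge e ⊆ C).card : ℝ) =
          ∑ φ ∈ S.emb N n, ((B.filter fun f => patternEdge (φ, f) ⊆ C).card : ℝ) := by
        rw [Finset.card_filter, Finset.sum_product]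
        push_cast [Finset.card_filter]
        rfl
      have hsp := hsparse C hC
      rw [hsum, Finset.card_product, div_mul_eq_mul_div, le_div_iff₀ (by positivity)] at hsp
      push_cast at hsp
      have hle : ∑ φ ∈ S.emb N n,
          (volume : Measure (S.V N → I)).real (projDown φ (templateBox κ C) ∩ b) ≤
          ∑ φ ∈ S.emb N n, ((B.filter fun f => patternEdge (φ, f) ⊆ C).card : ℝ) :=
        Finset.sum_le_sum fun φ _ => volume_real_projDown_templateBox_le κ C φ b B hB
      refine hle.trans_lt ?_
      have hεa : 0 < ε * ((S.emb N n).card : ℝ) := by positivity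
      have hB0 : (0 : ℝ) ≤ B.card := Nat.cast_nonneg _
      refine lt_of_mul_lt_mul_right (hsp.trans_lt ?_) (by positivity : (0 : ℝ) ≤ 2 * (B.card + 1))
      nlinarith
    · calc _ ≤ (𝒞.card : ℝ) := by exact_mod_cast Finset.card_image_le
        _ ≤ _ := hcard
        _ ≤ _ := by
          rw [Real.exp_le_exp, Fintype.card_prod, div_mul_eq_mul_div,
            div_le_iff₀ (by positivity)]
          push_cast
          have : 0 ≤ ε * (Fintype.card (S.V n) : ℝ) := by positivity
          nlinarith
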